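/- Let $(R,\mathfrak m)$ be a one-dimensional Noetherian Cohen–Macaulay local ring with infinite residue field $R/\mathfrak m$. Assume that $R$ is analytically unramified, i.e. that its $\mathfrak m$-adic completion is reduced. Let $\nu=\dim_{R/\mathfrak m}\mathfrak m/\mathfrak m^2$ be the embedding dimension of $R$, let $\overline R$ be the integral closure of $R$ in its total ring of fractions, and let $\mathfrak c=R:\overline R=\{r\in R: r\overline R\subseteq R\}$ be the conductor. Assume that $\mathfrak c$ is $\mathfrak m$-primary. Then the lengths $\ell(R/\mathfrak c^n)$, $n\ge 0$, are finite, the Hilbert–Samuel multiplicity $$e(\mathfrak c)=\lim_{n\to\infty}\frac{\ell(R/\mathfrak c^n)}{n}$$ of $\mathfrak c$ exists, and $$e(\mathfrak c)\ \le\ (\nu-1)\,\ell(R/\mathfrak c)^2+\ell(R/\mathfrak c)\ \le\ \nu\cdot\ell(R/\mathfrak c)^2 .$$ Moreover, $e(\mathfrak c)=(\nu-1)\,\ell(R/\mathfrak c)^2+\ell(R/\mathfrak c)$ if and only if $\ell(R/\mathfrak c)=1$, and $e(\mathfrak c)=\nu\cdot\ell(R/\mathfrak c)^2$ if and only if $\ell(R/\mathfrak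 c)=1$. -/

import Mathlib

open Filter Topology

/-- The depth of a local ring `(R, 𝔪)`: the supremum of the lengths of the `R`-regular sequences
of elements of `𝔪`. -/
noncomputable def localDepth (R : Type*) [CommRing R] [IsLocalRing R] : ℕ∞ :=
  ⨆ rs : {rs : List R // RingTheory.Sequence.IsRegular R rs ∧
    ∀ r ∈ rs, r ∈ IsLocalRing.maximalIdeal R}, (rs.1.length : ℕ∞)

/-- A Noetherian local ring is Cohen-Macaulay if its depth equals its Krull dimension. -/
class IsCohenMacaulayLocalRing (R : Type*) [CommRing R] : Prop
    extends IsLocalRing R, IsNoetherianRing R where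
  depth_eq_dim : (localDepth R : WithBot ℕ∞) = ringKrullDim R

/-- A local ring `(R, 𝔪)` is analytically unramified if its `𝔪`-adic completion is reduced. -/
def IsAnalyticallyUnramified (R : Type*) [CommRing R] [IsLocalRing R] : Prop :=
  IsReduced (AdicCompletion (IsLocalRing.maximalIdeal R) R)

/-- The conductor `𝔠 = R : R̄` of a ring `R`, where `R̄` is the integral closure of `R` in its
total ring of fractions `FractionRing R` (the localization of `R` at its non-zero-divisors). -/
noncomputable def conductorIdeal (R : Type*) [CommRing R] : Ideal R :=
  (1 : Submodule R (FractionRing R)).colon (integralClosure R (FractionRing R) : Set (FractionRing R))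

theorem mem_conductorIdeal {R : Type*} [CommRing R] {r : R} :
    r ∈ conductorIdeal R ↔ ∀ y : FractionRing R, IsIntegral R y →
      ∃ s : R, algebraMap R (FractionRing R) s = algebraMap R (FractionRing R) r * y := by
  simp [conductorIdeal, Submodule.mem_colon, Submodule.mem_one, mem_integralClosure_iff,
    Algebra.smul_def]

/-- The length `ℓ(R/I)` as a natural number (meaningful when it is finite). -/
noncomputable def colength {R : Type*} [CommRing R] (I : Ideal R) : ℕ :=
  (Module.length R (R ⧸ I)).toNat

/-- The sequence `n ↦ d! ℓ(R/Iⁿ) / n^d`, with `d = dim R`, whose limit is the Hilbert-Samuel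
multiplicity of `I`. -/
noncomputable def hilbertSamuelSeq {R : Type*} [CommRing R] (I : Ideal R) (n : ℕ) : ℝ :=
  (((ringKrullDim R).unbotD 0).toNat.factorial : ℝ) * (colength (I ^ n) : ℝ) /
    (n : ℝ) ^ ((ringKrullDim R).unbotD 0).toNat

/-- The Hilbert-Samuel multiplicity `e(I) = lim_{n → ∞} d! ℓ(R/Iⁿ) / n^d` of an `𝔪`-primary ideal
`I` of a Noetherian local ring `(R, 𝔪)` of dimension `d`. -/
noncomputable def hilbertSamuelMultiplicity {R : Type*} [CommRing R] (I : Ideal R) : ℝ :=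
  limUnder atTop (hilbertSamuelSeq I)

/-- The embedding dimension `dim_k 𝔪/𝔪²` of a local ring `(R, 𝔪)` with residue field `k`. -/
noncomputable def embeddingDim (R : Type*) [CommRing R] [IsLocalRing R] : ℕ :=
  Module.finrank (IsLocalRing.ResidueField R) (IsLocalRing.CotangentSpace R)

/-!
Let `S` be the integral closure of `R` in its total ring of fractions, `c` the conductor, `𝔪` the
maximal ideal, `ℓ = ℓ(R / c)`, and `E = ℓ(S / cS)`.

*The multiplicity is `E`.* As `R` has depth one and `c` is `𝔪`-primary, `c` contains a
non-zero-divisor `t`. So `S ⊆ t⁻¹R` is a finite `R`-module; it is a semilocal ring and `S / tS` is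
Artinian. In such an integrally closed ring the ideal `c = cS` is invertible
(`mul_one_div_eq_one`), hence principal, `c = xS` (`exists_conductorIdeal_eq_span`). Therefore
`cⁿ = xⁿS ≅ S` as `R`-modules for `n ≥ 1`, and `ℓ(R / cⁿ⁺¹) = nE + ℓ`
(`length_quotient_pow_succ`), which gives `e(c) = E`.

*The bound.* For every `R`-module `N` and `𝔪`-primary `I`, filtering `R / I` by copies of the
residue field gives `ℓ(N / IN) ≤ ℓ(N / 𝔪N) ℓ(R / I)` (`length_smul_top_le_mul`). Put
`μ = ℓ(S / 𝔪S)`. With `N = S` the inequality reads `E ≤ μℓ`. Since `c ≅ S`, also `μ = ℓ(c / 𝔪c)`,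
and `ℓ(R / 𝔪c)` computed through `c` and through `𝔪` gives `μ + ℓ = 1 + ℓ(𝔪 / c𝔪)`
(`length_quotient_maximalIdeal_smul_add`). With `N = 𝔪` the right-hand side is at most `1 + νℓ`, so
`μ ≤ (ν - 1)ℓ + 1` and `E ≤ (ν - 1)ℓ² + ℓ`.

*Equality.* If `ℓ = 1`, then `c = 𝔪`, and `E = μ = ν`. If `ℓ ≥ 2`, the step of the filtration
from an ideal of colength two to `𝔪` is strict (`length_maximalIdeal_smul_lt`) because
`ν ≥ 2`: for `ν ≤ 1` the bound would give `E ≤ ℓ`, against `R / c ⊊ S / c`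
(`length_quotient_lt_length_smul_top`).
-/

/-! ### Lengths of quotients `N / IN` over a local ring -/

/-- If a linear map `P → N / A` covers `B / A`, then `ℓ(N/A) ≤ ℓ(N/B) + ℓ(P)`. -/
theorem length_quotient_le_add {R N P : Type*} [CommRing R] [AddCommGroup N] [Module R N]
    [AddCommGroup P] [Module R P] (A B : Submodule R N) (f : P →ₗ[R] N ⧸ A)
    (h : B.map A.mkQ ≤ LinearMap.range f) :
    Module.length R (N ⧸ A) ≤ Module.length R (N ⧸ B) + Module.length R P := by
  rw [Module.length_eq_add_of_exact (LinearMap.range f).subtype (LinearMap.range f).mkQ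
    (Submodule.subtype_injective _) (Submodule.mkQ_surjective _)
    (LinearMap.exact_subtype_mkQ _), add_comm]
  refine add_le_add ?_ (Module.length_le_of_surjective f.rangeRestrict f.surjective_rangeRestrict)
  refine Module.length_le_of_surjective
    (B.liftQ ((LinearMap.range f).mkQ ∘ₗ A.mkQ) fun b hb => ?_) ?_
  · rw [LinearMap.mem_ker, LinearMap.comp_apply, Submodule.mkQ_apply,
      Submodule.Quotient.mk_eq_zero]
    exact h (Submodule.mem_map_of_mem hb)
  · rw [← LinearMap.range_eq_top, Submodule.range_liftQ, LinearMap.range_eq_top]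
    exact (Submodule.mkQ_surjective _).comp (Submodule.mkQ_surjective _)

theorem length_quotient_eq_add {R M : Type*} [CommRing R] [AddCommGroup M] [Module R M]
    (A B : Submodule R M) (h : A ≤ B) : Module.length R (M ⧸ A) =
      Module.length R (B.map A.mkQ) + Module.length R (M ⧸ B) := by
  rw [Module.length_eq_add_of_exact (B.map A.mkQ).subtype (B.map A.mkQ).mkQ
    (Submodule.subtype_injective _) (Submodule.mkQ_surjective _) (LinearMap.exact_subtype_mkQ _),
    (Submodule.quotientQuotientEquivQuotient A B h).length_eq]

theorem length_quotient_add_one_le {R M : Type*} [CommRing R] [AddCommGroup M] [Module R M]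
    {A B : Submodule R M} (h : A < B) :
    Module.length R (M ⧸ B) + 1 ≤ Module.length R (M ⧸ A) := by
  rw [length_quotient_eq_add A B h.le, add_comm]
  refine add_le_add_left (Order.one_le_iff_pos.mpr (Module.length_pos_iff.mpr ?_)) _
  rw [Submodule.nontrivial_iff_ne_bot]
  exact fun h' => h.not_ge <| by simpa using Submodule.map_le_iff_le_comap.mp h'.le

/-- `ℓ(R / IN) = ℓ(N / IN) + ℓ(R / N)`, the quotient `N / IN` being one of abstract modules. -/
theorem length_quotient_ideal_mul {R : Type*} [CommRing R] (I N : Ideal R) :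
    Module.length R (R ⧸ I * N) =
      Module.length R (N ⧸ (I • ⊤ : Submodule R N)) + Module.length R (R ⧸ N) := by
  have hle : I * N ≤ N := Ideal.mul_le_right
  have hmap : (I • ⊤ : Submodule R N).map N.subtype = I * N := by
    rw [Submodule.map_smul'', Submodule.map_top, Submodule.range_subtype, smul_eq_mul]
  refine Module.length_eq_add_of_exact
    ((I • ⊤ : Submodule R N).mapQ (I * N) N.subtype (Submodule.map_le_iff_le_comap.mp hmap.le))
    (Submodule.factor hle) ?_ (Submodule.factor_surjective hle) ?_
  · rw [← LinearMap.ker_eq_bot, LinearMap.ker_eq_bot']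
    rintro ⟨x⟩ hx
    have hx' : (x : R) ∈ I * N := (Submodule.Quotient.mk_eq_zero _).mp hx
    rw [← hmap] at hx'
    obtain ⟨y, hy, hyx⟩ := hx'
    exact (Submodule.Quotient.mk_eq_zero _).mpr (Subtype.ext hyx ▸ hy)
  · rintro ⟨r⟩
    constructor
    · intro hr
      have hr' : r ∈ N := (Submodule.Quotient.mk_eq_zero _).mp hr
      exact ⟨Submodule.Quotient.mk ⟨r, hr'⟩, rfl⟩
    · rintro ⟨⟨x⟩, hx⟩
      rw [← hx]
      exact (Submodule.Quotient.mk_eq_zero _).mpr x.2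

theorem lt_sup_span_singleton {R : Type*} [CommRing R] {I : Ideal R} {z : R} (hz : z ∉ I) :
    I < I ⊔ Ideal.span {z} :=
  left_lt_sup.mpr fun h => hz (h (Ideal.mem_span_singleton_self z))

section LocalRing

open IsLocalRing

variable {R : Type*} [CommRing R] [IsLocalRing R]

/-- A proper ideal containing a power of the maximal ideal `𝔪` has a socle element modulo it. -/
theorem exists_notMem_forall_mul_mem {I : Ideal R} (hI : I ≠ ⊤)
    (hk : ∃ k, maximalIdeal R ^ k ≤ I) :
    ∃ z ∉ I, ∀ a ∈ maximalIdeal R, a * z ∈ I := by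
  classical
  have hk0 : Nat.find hk ≠ 0 := fun h0 => hI <| by
    simpa [h0] using Nat.find_spec hk
  obtain ⟨j, hj⟩ := Nat.exists_eq_succ_of_ne_zero hk0
  have hnot : ¬ maximalIdeal R ^ j ≤ I := Nat.find_min hk (by omega)
  obtain ⟨z, hz, hzI⟩ := SetLike.not_le_iff_exists.mp hnot
  refine ⟨z, hzI, fun a ha => ?_⟩
  have := Nat.find_spec hk
  rw [hj, pow_succ'] at this
  exact this (Ideal.mul_mem_mul ha hz)

/-- Adding to `I` a socle element modulo `I` lowers the length of `N / IN` by at most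
`ℓ(N / 𝔪N)`: multiplication by the socle element maps `N / 𝔪N` onto the kernel of the
projection. -/
theorem length_smul_top_le_sup_span {N : Type*} [AddCommGroup N] [Module R N] {I : Ideal R} {z : R}
    (hz : ∀ a ∈ maximalIdeal R, a * z ∈ I) :
    Module.length R (N ⧸ (I • ⊤ : Submodule R N)) ≤
      Module.length R (N ⧸ ((I ⊔ Ideal.span {z}) • ⊤ : Submodule R N)) +
        Module.length R (N ⧸ (maximalIdeal R • ⊤ : Submodule R N)) := by
  refine length_quotient_le_add _ _
    ((maximalIdeal R • ⊤ : Submodule R N).mapQ (I • ⊤) (LinearMap.lsmul R N z) ?_) ?_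
  · rw [← Submodule.map_le_iff_le_comap, Submodule.map_smul'', Submodule.map_top,
      Submodule.smul_le]
    rintro a ha _ ⟨n, rfl⟩
    rw [LinearMap.lsmul_apply, smul_smul]
    exact Submodule.smul_mem_smul (hz a ha) trivial
  · rw [Submodule.map_le_iff_le_comap, Submodule.smul_le]
    rintro r hr n -
    obtain ⟨i, hi, y, hy, rfl⟩ := Submodule.mem_sup.mp hr
    obtain ⟨c, rfl⟩ := Ideal.mem_span_singleton'.mp hy
    refine ⟨Submodule.Quotient.mk (c • n), ?_⟩
    rw [Submodule.mapQ_apply, Submodule.mkQ_apply, Submodule.Quotient.eq]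
    have : LinearMap.lsmul R N z (c • n) - (i + c * z) • n
        = -(i • n) := by
      simp only [LinearMap.lsmul_apply, add_smul, mul_smul]
      rw [smul_comm z c]; abel
    rw [this]
    exact neg_mem (Submodule.smul_mem_smul hi trivial)

/-- Induction over the ideals containing a power of the maximal ideal, by adding socle elements. -/
theorem ideal_socle_induction [IsNoetherianRing R]
    {P : ∀ I : Ideal R, (∃ k, maximalIdeal R ^ k ≤ I) → Prop} (top : P ⊤ ⟨0, le_top⟩)
    (step : ∀ (I : Ideal R) (z : R) (hk : ∃ k, maximalIdeal R ^ k ≤ I), z ∉ I →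
      (∀ a ∈ maximalIdeal R, a * z ∈ I) →
      P (I ⊔ Ideal.span {z}) (hk.imp fun _ h => h.trans le_sup_left) → P I hk)
    (I : Ideal R) (hk : ∃ k, maximalIdeal R ^ k ≤ I) : P I hk := by
  induction I using WellFoundedGT.induction with
  | ind I ih =>
    by_cases hI : I = ⊤
    · subst hI
      exact top
    obtain ⟨z, hzI, hz⟩ := exists_notMem_forall_mul_mem hI hk
    exact step I z hk hzI hz (ih _ (lt_sup_span_singleton hzI) _)

/-- Each step of a filtration of `R / I` by copies of the residue field contributes at most
`ℓ(N / 𝔪N)` to `ℓ(N / IN)`. -/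
theorem length_smul_top_le_mul [IsNoetherianRing R] (N : Type*) [AddCommGroup N] [Module R N]
    {I : Ideal R} (hk : ∃ k, maximalIdeal R ^ k ≤ I) :
    Module.length R (N ⧸ (I • ⊤ : Submodule R N)) ≤
      Module.length R (N ⧸ (maximalIdeal R • ⊤ : Submodule R N)) * Module.length R (R ⧸ I) := by
  induction I, hk using ideal_socle_induction with
  | top =>
    have : Subsingleton (N ⧸ ((⊤ : Ideal R) • ⊤ : Submodule R N)) := by
      rw [Submodule.Quotient.subsingleton_iff, Submodule.top_smul]
    rw [Module.length_eq_zero]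
    exact zero_le
  | step I z hk hzI hz ih =>
    calc _ ≤ _ := length_smul_top_le_sup_span hz
      _ ≤ Module.length R (N ⧸ (maximalIdeal R • ⊤ : Submodule R N)) *
            (Module.length R (R ⧸ I ⊔ Ideal.span {z}) + 1) := by
          rw [mul_add, mul_one]; exact add_le_add_left ih _
      _ ≤ _ := mul_le_mul_right (length_quotient_add_one_le (lt_sup_span_singleton hzI)) _

theorem length_quotient_maximalIdeal : Module.length R (R ⧸ maximalIdeal R) = 1 :=
  have : IsSimpleModule R (R ⧸ maximalIdeal R) :=
    isSimpleModule_iff_isCoatom.mpr (maximalIdeal.isMaximal R).out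
  Module.length_eq_one _ _

theorem length_maximalIdeal_smul [IsNoetherianRing R] :
    Module.length R (maximalIdeal R ⧸ (maximalIdeal R • ⊤ : Submodule R (maximalIdeal R))) =
      embeddingDim R := by
  rw [embeddingDim, ← Module.length_eq_finrank]
  exact Module.length_eq_of_surjective (R := ResidueField R) (M := CotangentSpace R) (S := R)
    residue_surjective

/-- If `𝔪 = I + (z)` and `𝔪z ⊆ I`, then `𝔪² = I𝔪 + (z²)` and `z²` is killed by `𝔪` modulo
`I𝔪`, so `ℓ(𝔪 / I𝔪) ≤ ν + 1`. -/
theorem length_maximalIdeal_smul_le_of_sup_span [IsNoetherianRing R] {I : Ideal R} {z : R}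
    (hz : ∀ a ∈ maximalIdeal R, a * z ∈ I) (hI : I ⊔ Ideal.span {z} = maximalIdeal R) :
    Module.length R (maximalIdeal R ⧸ (I • ⊤ : Submodule R (maximalIdeal R))) ≤
      embeddingDim R + 1 := by
  have hzm : z ∈ maximalIdeal R :=
    hI ▸ Ideal.mem_sup_right (Ideal.mem_span_singleton_self z)
  let w : maximalIdeal R := ⟨z, hzm⟩
  rw [← length_maximalIdeal_smul, ← length_quotient_maximalIdeal (R := R)]
  refine length_quotient_le_add _ _
    ((maximalIdeal R).mapQ (I • ⊤ : Submodule R (maximalIdeal R))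
      (LinearMap.toSpanSingleton R (maximalIdeal R) (z • w)) ?_) ?_
  · intro a ha
    rw [Submodule.mem_comap, LinearMap.toSpanSingleton_apply, smul_smul]
    exact Submodule.smul_mem_smul (hz a ha) trivial
  · have hdec : ∀ r ∈ maximalIdeal R, ∃ i ∈ I, ∃ c, r = i + c * z := fun r hr => by
      rw [← hI] at hr
      obtain ⟨i, hi, y, hy, rfl⟩ := Submodule.mem_sup.mp hr
      obtain ⟨c, rfl⟩ := Ideal.mem_span_singleton'.mp hy
      exact ⟨i, hi, c, rfl⟩
    rw [Submodule.map_le_iff_le_comap, Submodule.smul_le]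
    rintro r hr ⟨n, hn⟩ -
    obtain ⟨i, hi, c, rfl⟩ := hdec r hr
    obtain ⟨j, hj, d, rfl⟩ := hdec n hn
    refine ⟨Submodule.Quotient.mk (c * d), ?_⟩
    rw [Submodule.mapQ_apply, Submodule.mkQ_apply, Submodule.Quotient.eq]
    have hjm : j ∈ maximalIdeal R := hI ▸ Ideal.mem_sup_left hj
    have : LinearMap.toSpanSingleton R (maximalIdeal R) (z • w) (c * d) -
        (i + c * z) • (⟨j + d * z, hn⟩ : maximalIdeal R) =
        -(i • (⟨j + d * z, hn⟩ : maximalIdeal R) + j • (c • w)) := by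
      ext
      simp only [w, LinearMap.toSpanSingleton_apply, Submodule.coe_sub, Submodule.coe_smul,
        smul_eq_mul, Submodule.coe_neg, Submodule.coe_add]
      ring
    rw [this]
    exact neg_mem (add_mem (Submodule.smul_mem_smul hi trivial)
      (Submodule.smul_mem_smul hj trivial))

/-- Strictness in `ℓ(𝔪 / I𝔪) ≤ ν ℓ(R / I)`: one step of the filtration of `R / I`, between
an ideal of colength two and `𝔪`, contributes at most `1 < ν`. -/
theorem length_maximalIdeal_smul_lt [IsNoetherianRing R] (hν : 2 ≤ embeddingDim R)
    {I : Ideal R} (hk : ∃ k, maximalIdeal R ^ k ≤ I) (hI : I < maximalIdeal R) :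
    Module.length R (maximalIdeal R ⧸ (I • ⊤ : Submodule R (maximalIdeal R))) + 1 ≤
      embeddingDim R * Module.length R (R ⧸ I) := by
  induction I, hk using ideal_socle_induction with
  | top => exact absurd hI not_top_lt
  | step I z hk hzI hz ih =>
    have hlt := lt_sup_span_singleton hzI
    have hle : I ⊔ Ideal.span {z} ≤ maximalIdeal R := by
      refine sup_le hI.le ((Ideal.span_singleton_le_iff_mem _).mpr ?_)
      -- a unit `z` would give `𝔪 ≤ I`
      by_contra hzm
      obtain ⟨u, rfl⟩ := notMem_maximalIdeal.mp hzm
      refine hI.not_ge fun a ha => ?_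
      simpa using I.mul_mem_right ↑u⁻¹ (hz a ha)
    rcases hle.eq_or_lt with h | h
    · have h2 : (2 : ℕ∞) ≤ Module.length R (R ⧸ I) := by
        have := length_quotient_add_one_le hI
        rwa [length_quotient_maximalIdeal, one_add_one_eq_two] at this
      calc _ ≤ (embeddingDim R + 1 + 1 : ℕ∞) :=
            add_le_add_left (length_maximalIdeal_smul_le_of_sup_span hz h) _
        _ ≤ embeddingDim R * 2 := by norm_cast; omega
        _ ≤ _ := mul_le_mul_right h2 _
    · calc _ ≤ _ := add_le_add_left (length_smul_top_le_sup_span hz) _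
        _ ≤ embeddingDim R * (Module.length R (R ⧸ I ⊔ Ideal.span {z}) + 1) := by
          rw [mul_add, mul_one, length_maximalIdeal_smul, add_right_comm]
          exact add_le_add_left (ih h) _
        _ ≤ _ := mul_le_mul_right (length_quotient_add_one_le hlt) _

end LocalRing

/-! ### Regular ideals of an integrally closed ring of dimension one -/

theorem isNoetherian_of_forall_smul_mem_one {A Q : Type*} [CommRing A] [IsNoetherianRing A]
    [CommRing Q] [Algebra A Q] {N : Submodule A Q} {t : A} (ht : IsUnit (algebraMap A Q t))
    (h : ∀ q ∈ N, t • q ∈ (1 : Submodule A Q)) : IsNoetherian A N := by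
  have : IsNoetherian A (1 : Submodule A Q) :=
    isNoetherian_of_fg_of_noetherian _
      ⟨{1}, by rw [Finset.coe_singleton, Submodule.one_eq_span]⟩
  refine isNoetherian_of_injective
    (((LinearMap.lsmul A Q t).domRestrict N).codRestrict 1 fun q => h q q.2) fun p q hpq => ?_
  have : t • (p : Q) = t • (q : Q) := congrArg Subtype.val hpq
  rw [Algebra.smul_def, Algebra.smul_def] at this
  exact Subtype.ext (ht.mul_left_cancel this)

/-- A prime `M` containing `t` with `A / tA` Artinian is associated to `A / tA`. -/
theorem exists_notMem_span_forall_mul_mem_span {A : Type*} [CommRing A] {t : A}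
    [IsArtinianRing (A ⧸ Ideal.span {t})] {M : Ideal A} [hM : M.IsPrime] (htM : t ∈ M) :
    ∃ b ∉ Ideal.span {t}, ∀ a ∈ M, b * a ∈ Ideal.span {t} := by
  have hle : Ideal.span {t} ≤ M := (Ideal.span_singleton_le_iff_mem _).mpr htM
  set B := A ⧸ Ideal.span {t}
  have hker : RingHom.ker (Ideal.Quotient.mk (Ideal.span {t})) ≤ M := by
    rwa [Ideal.mk_ker]
  have hprime : (M.map (Ideal.Quotient.mk (Ideal.span {t}))).IsPrime :=
    Ideal.map_isPrime_of_surjective Ideal.Quotient.mk_surjective hker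
  have hmin : M.map (Ideal.Quotient.mk (Ideal.span {t})) ∈
      (Module.annihilator B B).minimalPrimes := by
    refine ⟨⟨hprime, ?_⟩, fun P hP hPM => ?_⟩
    · rw [Module.annihilator_eq_bot.mpr inferInstance]
      exact bot_le
    · have := hP.1
      exact ((IsArtinianRing.isMaximal_of_isPrime P).eq_of_le hprime.ne_top hPM).ge
  obtain ⟨-, x, hx⟩ := (isAssociatedPrime_iff (R := B) (M := B)).mp
    (Module.associatedPrimes.minimalPrimes_annihilator_subset_associatedPrimes B B hmin)
  obtain ⟨b, rfl⟩ := Ideal.Quotient.mk_surjective x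
  refine ⟨b, fun hb => hprime.ne_top ?_, fun a ha => ?_⟩
  · rw [hx, Ideal.Quotient.eq_zero_iff_mem.mpr hb, Ideal.eq_top_iff_one,
      Submodule.mem_colon_singleton, smul_zero]
    exact zero_mem _
  · have := Ideal.mem_map_of_mem (Ideal.Quotient.mk (Ideal.span {t})) ha
    rw [hx, Submodule.mem_colon_singleton, Submodule.mem_bot, smul_eq_mul, ← map_mul,
      Ideal.Quotient.eq_zero_iff_mem] at this
    rwa [mul_comm]

/-- In a Noetherian ring `A` integrally closed in a localization `Q`, an ideal `C` containing an
element `t` of the localizing set, with `A / tA` Artinian, is invertible. -/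
theorem mul_one_div_eq_one {A Q : Type*} [CommRing A] [IsNoetherianRing A] [CommRing Q]
    [Algebra A Q] (hint : ∀ q : Q, IsIntegral A q → q ∈ (1 : Submodule A Q))
    {t : A} (ht : IsUnit (algebraMap A Q t)) (hinj : Function.Injective (algebraMap A Q))
    [IsArtinianRing (A ⧸ Ideal.span {t})] {C : Ideal A} (htC : t ∈ C) :
    IsLocalization.coeSubmodule Q C * (1 / IsLocalization.coeSubmodule Q C) = 1 := by
  set D := 1 / IsLocalization.coeSubmodule Q C with hD
  have hDmem : ∀ q : Q, q ∈ D ↔ ∀ a ∈ C, q * algebraMap A Q a ∈ (1 : Submodule A Q) := fun q => by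
    simp [hD, Submodule.mem_div_iff_forall_mul_mem]
  have hle : IsLocalization.coeSubmodule Q C * D ≤ 1 := Submodule.mul_one_div_le_one
  have hone : (1 : Q) ∈ D := (hDmem 1).mpr fun a _ => by
    rw [one_mul]; exact Submodule.algebraMap_mem a
  refine hle.antisymm ?_
  set J : Ideal A := (IsLocalization.coeSubmodule Q C * D).comap (Algebra.linearMap A Q) with hJ
  by_cases hJtop : J = ⊤
  · rw [Submodule.one_le]
    have : (1 : A) ∈ J := hJtop ▸ trivial
    simpa [hJ] using this
  obtain ⟨M, hM, hJM⟩ := Ideal.exists_le_maximal J hJtop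
  have htM : t ∈ M := hJM <| by
    have := Submodule.mul_mem_mul (N := D)
      (IsLocalization.mem_coeSubmodule Q C |>.mpr ⟨t, htC, rfl⟩) hone
    simpa [hJ] using this
  obtain ⟨b, hbt, hb⟩ := exists_notMem_span_forall_mul_mem_span htM
  -- `β = b / t` is a non-integral element mapping `D` into itself
  obtain ⟨u, hu⟩ := ht
  set β : Q := algebraMap A Q b * ↑u⁻¹ with hβ
  have hβD : ∀ q ∈ D, q * β ∈ D := fun q hq => by
    refine (hDmem _).mpr fun a ha => ?_
    have hmem := Submodule.mul_mem_mul
      (IsLocalization.mem_coeSubmodule Q C |>.mpr ⟨a, ha, rfl⟩) hq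
    obtain ⟨j, hj⟩ := Submodule.mem_one.mp (hle hmem)
    have hjJ : j ∈ J := by rw [hJ, Submodule.mem_comap, Algebra.linearMap_apply, hj]; exact hmem
    obtain ⟨d, hd⟩ := Ideal.mem_span_singleton'.mp (hb j (hJM hjJ))
    refine Submodule.mem_one.mpr ⟨d, ?_⟩
    have : algebraMap A Q d * u = algebraMap A Q b * (algebraMap A Q a * q) := by
      rw [hu, ← hj, ← map_mul, ← map_mul, hd]
    rw [(Units.eq_mul_inv_iff_mul_eq u).mpr this, hβ]
    ring
  have hpow : ∀ n : ℕ, β ^ n ∈ D := fun n => by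
    induction n with
    | zero => simpa using hone
    | succ n ih => rw [pow_succ]; exact hβD _ ih
  have hDnoeth : IsNoetherian A D :=
    isNoetherian_of_forall_smul_mem_one (t := t) ⟨u, hu⟩ fun q hq => by
      rw [Algebra.smul_def, mul_comm]; exact (hDmem q).mp hq t htC
  have hβint : IsIntegral A β := by
    refine IsIntegral.of_mem_of_fg (Algebra.adjoin A {β}) ?_ β
      (Algebra.self_mem_adjoin_singleton A β)
    have hadj : Subalgebra.toSubmodule (Algebra.adjoin A {β}) ≤ D := by
      rw [Algebra.adjoin_eq_span, Submodule.span_le]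
      rintro _ hx
      obtain ⟨n, rfl⟩ := Submonoid.mem_closure_singleton.mp hx
      exact hpow n
    exact (isNoetherian_submodule.mp hDnoeth) _ hadj
  obtain ⟨s, hs⟩ := Submodule.mem_one.mp (hint β hβint)
  refine absurd (Ideal.mem_span_singleton'.mpr ⟨s, hinj ?_⟩) hbt
  rw [map_mul, hs, ← hu, hβ, mul_assoc, Units.inv_mul, mul_one]

/-- In a semilocal ring as in `mul_one_div_eq_one` the invertible ideal `C` is principal. -/
theorem isPrincipal_of_isIntegrallyClosedIn {A Q : Type*} [CommRing A] [IsNoetherianRing A]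
    [CommRing Q] [Algebra A Q] {T : Submonoid A} [IsLocalization T Q]
    (hT : T ≤ nonZeroDivisors A) (hint : ∀ q : Q, IsIntegral A q → q ∈ (1 : Submodule A Q))
    (hfin : {M : Ideal A | M.IsMaximal}.Finite) {t : A} (ht : t ∈ T)
    [IsArtinianRing (A ⧸ Ideal.span {t})] {C : Ideal A} (htC : t ∈ C) :
    ∃ x, C = Ideal.span {x} := by
  have hinv := mul_one_div_eq_one (Q := Q) hint (IsLocalization.map_units Q ⟨t, ht⟩)
    (IsLocalization.injective Q hT) htC
  have hfrac : IsFractional T (1 / IsLocalization.coeSubmodule Q C) := by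
    refine ⟨t, ht, fun q hq => ?_⟩
    rw [Submodule.mem_div_iff_forall_mul_mem] at hq
    obtain ⟨a, ha⟩ := Submodule.mem_one.mp
      (hq _ ((IsLocalization.mem_coeSubmodule Q C).mpr ⟨t, htC, rfl⟩))
    exact ⟨a, by rw [ha, Algebra.smul_def, mul_comm]⟩
  obtain ⟨D, hD⟩ : ∃ D : FractionalIdeal T Q,
      (D : Submodule A Q) = 1 / IsLocalization.coeSubmodule Q C := ⟨⟨_, hfrac⟩, rfl⟩
  have hprin := FractionalIdeal.isPrincipal.of_finite_maximals_of_inv hT hfin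
    (C : FractionalIdeal T Q) D (by
      rw [FractionalIdeal.coe_ext_iff, FractionalIdeal.coe_mul, FractionalIdeal.coe_one, hD]
      exact hinv)
  rw [FractionalIdeal.coe_coeIdeal] at hprin
  have := (IsLocalization.coeSubmodule_isPrincipal Q hT (I := C)).mp hprin
  exact ⟨_, (Submodule.IsPrincipal.span_singleton_generator C).symm⟩

/-! ### The integral closure and the conductor -/

open IsLocalRing

theorem isArtinianRing_quotient_map {R S : Type*} [CommRing R] [CommRing S] [Algebra R S]
    [Module.Finite R S] (I : Ideal R) [IsArtinianRing (R ⧸ I)] :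
    IsArtinianRing (S ⧸ I.map (algebraMap R S)) := by
  have : Module.Finite (R ⧸ I) (S ⧸ I.map (algebraMap R S)) :=
    Module.Finite.of_restrictScalars_finite R _ _
  exact IsArtinianRing.of_finite (R ⧸ I) _

theorem finite_isMaximal_of_finite {R S : Type*} [CommRing R] [IsLocalRing R] [CommRing S]
    [Algebra R S] [Module.Finite R S] : {M : Ideal S | M.IsMaximal}.Finite := by
  have : IsArtinianRing (R ⧸ maximalIdeal R) :=
    inferInstanceAs (IsArtinianRing (ResidueField R))
  have := isArtinianRing_quotient_map (S := S) (maximalIdeal R)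
  set J := (maximalIdeal R).map (algebraMap R S)
  refine (Set.finite_range fun P : MaximalSpectrum (S ⧸ J) =>
    P.asIdeal.comap (Ideal.Quotient.mk J)).subset fun M (hM : M.IsMaximal) => ?_
  have hJM : J ≤ M := by
    rw [Ideal.map_le_iff_le_comap]
    have := Ideal.isMaximal_comap_of_isIntegral_of_isMaximal (R := R) M
    exact (eq_maximalIdeal this).ge
  have hcomap : (M.map (Ideal.Quotient.mk J)).comap (Ideal.Quotient.mk J) = M :=
    (Ideal.comap_map_quotientMk J M).trans (sup_eq_right.mpr hJM)
  refine ⟨⟨M.map (Ideal.Quotient.mk J), (Ideal.map_eq_top_or_isMaximal_of_surjective _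
    Ideal.Quotient.mk_surjective hM).resolve_left fun h => hM.ne_top ?_⟩, hcomap⟩
  rw [← hcomap, h, Ideal.comap_top]

theorem isLocalization_algebraMapSubmonoid_integralClosure {R Q : Type*} [CommRing R] [CommRing Q]
    [Algebra R Q] (T : Submonoid R) [IsLocalization T Q] :
    IsLocalization (Algebra.algebraMapSubmonoid (integralClosure R Q) T) Q where
  map_units := by
    rintro ⟨_, t, ht, rfl⟩
    exact IsLocalization.map_units Q ⟨t, ht⟩
  surj q := by
    obtain ⟨⟨r, t⟩, h⟩ := IsLocalization.surj T q
    exact ⟨⟨algebraMap R _ r, ⟨algebraMap R _ t, t, t.2, rfl⟩⟩, h⟩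
  exists_of_eq h := ⟨1, by rw [Subtype.ext h]⟩

theorem exists_mem_nonZeroDivisors_of_localDepth_eq_one {R : Type*} [CommRing R] [IsLocalRing R]
    (h : localDepth R = 1) : ∃ a ∈ maximalIdeal R, a ∈ nonZeroDivisors R := by
  by_contra! hno
  have : localDepth R ≤ 0 := iSup_le fun ⟨rs, hreg, hmem⟩ => by
    rcases rs with _ | ⟨a, rs⟩
    · simp
    · refine absurd ?_ (hno a (hmem a (by simp)))
      have := ((RingTheory.Sequence.isWeaklyRegular_cons_iff R a rs).mp hreg.1).1
      exact mem_nonZeroDivisors_iff_right.mpr fun b hb => this <| by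
        simpa [mul_comm a] using hb
  rw [h] at this
  exact absurd this (by simp)

/-- The conductor is an ideal of the integral closure: its extension has no new elements. -/
theorem mem_map_conductorIdeal_iff {R : Type*} [CommRing R]
    {s : integralClosure R (FractionRing R)} :
    s ∈ (conductorIdeal R).map (algebraMap R (integralClosure R (FractionRing R))) ↔
      ∃ r ∈ conductorIdeal R, algebraMap R _ r = s := by
  constructor
  · intro hs
    refine Submodule.span_induction (p := fun s _ => ∃ r ∈ conductorIdeal R, algebraMap R _ r = s)
      ?_ ⟨0, zero_mem _, map_zero _⟩ ?_ ?_ hs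
    · rintro _ ⟨r, hr, rfl⟩
      exact ⟨r, hr, rfl⟩
    · rintro _ _ - - ⟨a, ha, rfl⟩ ⟨b, hb, rfl⟩
      exact ⟨a + b, add_mem ha hb, map_add _ _ _⟩
    · rintro y _ - ⟨a, ha, rfl⟩
      obtain ⟨b, hb⟩ := mem_conductorIdeal.mp ha y y.2
      refine ⟨b, mem_conductorIdeal.mpr fun z hz => ?_, Subtype.ext ?_⟩
      · obtain ⟨d, hd⟩ := mem_conductorIdeal.mp ha (y * z) (y.2.mul hz)
        exact ⟨d, by rw [hd, hb, mul_assoc]⟩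
      · exact hb.trans (mul_comm _ _)
  · rintro ⟨r, hr, rfl⟩
    exact Ideal.mem_map_of_mem _ hr

/-- An ideal `N` of `R` whose image is a principal ideal `yS` of an `R`-algebra `S`, with `y`
regular, is isomorphic to `S` as an `R`-module, so `ℓ(N / IN) = ℓ(S / IS)`. -/
theorem length_smul_top_eq_of_principal {R S : Type*} [CommRing R] [CommRing S] [Algebra R S]
    (hinj : Function.Injective (algebraMap R S)) {N : Ideal R} {y : S}
    (hy : y ∈ nonZeroDivisors S)
    (hN : ∀ s, s ∈ Ideal.span {y} ↔ ∃ r ∈ N, algebraMap R S r = s) (I : Ideal R) :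
    Module.length R (N ⧸ (I • ⊤ : Submodule R N)) =
      Module.length R (S ⧸ (I • ⊤ : Submodule R S)) := by
  choose f hf hfs using fun s : S =>
    (hN (s * y)).mp (Ideal.mem_span_singleton'.mpr ⟨s, rfl⟩)
  let g : S →ₗ[R] N :=
    { toFun s := ⟨f s, hf s⟩
      map_add' a b := Subtype.ext <| hinj <| by
        rw [Submodule.coe_add, map_add, hfs, hfs, hfs, add_mul]
      map_smul' a b := Subtype.ext <| hinj <| by
        rw [Submodule.coe_smul, smul_eq_mul, map_mul, hfs, RingHom.id_apply, hfs,
          Algebra.smul_def, mul_assoc] }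
  have hg : Function.Bijective g := by
    constructor
    · intro a b hab
      have : f a = f b := congrArg Subtype.val hab
      have := congrArg (algebraMap R S) this
      rw [hfs, hfs] at this
      exact (mul_cancel_right_mem_nonZeroDivisors hy).mp this
    · rintro ⟨r, hr⟩
      obtain ⟨s, hs⟩ := Ideal.mem_span_singleton'.mp ((hN _).mpr ⟨r, hr, rfl⟩)
      exact ⟨s, Subtype.ext <| hinj <| (hfs s).trans hs⟩
  let e := LinearEquiv.ofBijective g hg
  refine (Submodule.Quotient.equiv _ _ e ?_).symm.length_eq
  rw [Submodule.map_smul'', Submodule.map_top, LinearEquiv.range]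

/-! ### The multiplicity of the conductor -/

theorem length_quotient_ne_top {R : Type*} [CommRing R] [IsLocalRing R] [IsNoetherianRing R]
    {I : Ideal R} (hk : ∃ k, maximalIdeal R ^ k ≤ I) : Module.length R (R ⧸ I) ≠ ⊤ := by
  induction I, hk using ideal_socle_induction with
  | top =>
    have : Subsingleton (R ⧸ (⊤ : Ideal R)) := Submodule.Quotient.subsingleton_iff.mpr rfl
    rw [Module.length_eq_zero]
    exact ENat.zero_ne_top
  | step I z hk hzI hz ih =>
    have := length_smul_top_le_sup_span (N := R) hz
    rw [smul_eq_mul, Ideal.mul_top, smul_eq_mul, Ideal.mul_top, smul_eq_mul, Ideal.mul_top,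
      length_quotient_maximalIdeal] at this
    exact ne_top_of_le_ne_top (WithTop.add_ne_top.mpr ⟨ih, ENat.one_ne_top⟩) this

/-- If the image of `N` is the principal ideal `yS`, then the image of `Nⁿ⁺¹` is `yⁿ⁺¹S`. -/
theorem mem_span_pow_iff {R S : Type*} [CommRing R] [CommRing S] [Algebra R S] {N : Ideal R} {y : S}
    (hN : ∀ s, s ∈ Ideal.span {y} ↔ ∃ r ∈ N, algebraMap R S r = s) (n : ℕ) (s : S) :
    s ∈ Ideal.span {y ^ (n + 1)} ↔ ∃ r ∈ N ^ (n + 1), algebraMap R S r = s := by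
  constructor
  · intro hs
    obtain ⟨a, rfl⟩ := Ideal.mem_span_singleton'.mp hs
    clear hs
    induction n with
    | zero =>
      simpa using (hN (a * y)).mp (Ideal.mem_span_singleton'.mpr ⟨a, rfl⟩)
    | succ n ih =>
      obtain ⟨r, hr, hrs⟩ := ih
      obtain ⟨q, hq, hqs⟩ := (hN y).mp (Ideal.mem_span_singleton_self y)
      refine ⟨r * q, ?_, ?_⟩
      · rw [pow_succ]
        exact Ideal.mul_mem_mul hr hq
      · rw [map_mul, hrs, hqs, pow_succ y (n + 1), mul_assoc]
  · rintro ⟨r, hr, rfl⟩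
    have hmap : N.map (algebraMap R S) ≤ Ideal.span {y} :=
      Ideal.map_le_iff_le_comap.mpr fun a ha => (hN _).mpr ⟨a, ha, rfl⟩
    rw [← Ideal.span_singleton_pow]
    refine Ideal.pow_right_mono hmap _ ?_
    rw [← Ideal.map_pow]
    exact Ideal.mem_map_of_mem _ hr

section CommonIdeal

variable {R S : Type*} [CommRing R] [CommRing S] [Algebra R S] {c : Ideal R} {x : S}

/-- The positive powers of `c` are isomorphic to `S`, so each factor `cⁿ / cⁿ⁺¹` with `n ≥ 1` has
length `ℓ(S / cS)`; only `R / c` is different. -/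
theorem length_quotient_pow_succ (hinj : Function.Injective (algebraMap R S))
    (hx : x ∈ nonZeroDivisors S)
    (hc : ∀ s, s ∈ Ideal.span {x} ↔ ∃ r ∈ c, algebraMap R S r = s) (n : ℕ) :
    Module.length R (R ⧸ c ^ (n + 1)) =
      n * Module.length R (S ⧸ (c • ⊤ : Submodule R S)) + Module.length R (R ⧸ c) := by
  induction n with
  | zero => rw [zero_add, pow_one, Nat.cast_zero, zero_mul, zero_add]
  | succ n ih =>
    rw [pow_succ' c (n + 1), length_quotient_ideal_mul, ih,
      length_smul_top_eq_of_principal hinj (pow_mem hx (n + 1)) (mem_span_pow_iff hc n)]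
    push_cast
    ring

/-- An ideal `c` of `R` that is also an ideal `xS` of `S` satisfies `cS ∩ R = c`, so `R / c` is a
proper submodule of `S / cS` unless `R = S`. -/
theorem length_quotient_lt_length_smul_top
    (hc : ∀ s, s ∈ Ideal.span {x} ↔ ∃ r ∈ c, algebraMap R S r = s)
    (hinj : Function.Injective (algebraMap R S))
    (hsurj : ¬ Function.Surjective (algebraMap R S)) (hfin : Module.length R (R ⧸ c) ≠ ⊤) :
    Module.length R (R ⧸ c) < Module.length R (S ⧸ (c • ⊤ : Submodule R S)) := by
  have hle : c ≤ (c • ⊤ : Submodule R S).comap (Algebra.linearMap R S) := fun r hr => by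
    rw [Submodule.mem_comap, Algebra.linearMap_apply, Algebra.algebraMap_eq_smul_one]
    exact Submodule.smul_mem_smul hr trivial
  have hsmul : ∀ s ∈ (c • ⊤ : Submodule R S), ∃ r ∈ c, algebraMap R S r = s := fun s hs => by
    rw [← hc]
    refine (Submodule.smul_le (P := (Ideal.span {x}).restrictScalars R)).mpr ?_ hs
    intro r hr s _
    rw [Algebra.smul_def, mul_comm]
    exact Ideal.mul_mem_left _ s ((hc _).mpr ⟨r, hr, rfl⟩)
  let f := c.mapQ (c • ⊤ : Submodule R S) (Algebra.linearMap R S) hle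
  have hf : Function.Injective f := by
    rw [← LinearMap.ker_eq_bot, LinearMap.ker_eq_bot']
    rintro ⟨r⟩ hr
    obtain ⟨q, hq, hqr⟩ := hsmul _ ((Submodule.Quotient.mk_eq_zero _).mp hr)
    exact (Submodule.Quotient.mk_eq_zero _).mpr (hinj hqr ▸ hq)
  rw [Module.length_eq_add_of_exact f (LinearMap.range f).mkQ hf (Submodule.mkQ_surjective _)
    (LinearMap.exact_map_mkQ_range f)]
  refine (ENat.add_one_le_iff hfin).mp (add_le_add_right
    (Order.one_le_iff_pos.mpr (Module.length_pos_iff.mpr ?_)) _)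
  rw [Submodule.Quotient.nontrivial_iff]
  intro htop
  refine hsurj fun s => ?_
  obtain ⟨⟨r⟩, hr⟩ := LinearMap.range_eq_top.mp htop (Submodule.Quotient.mk s)
  obtain ⟨q, -, hq⟩ := hsmul _ ((Submodule.Quotient.eq _).mp hr)
  exact ⟨r - q, by rw [map_sub, hq, Algebra.linearMap_apply, sub_sub_cancel]⟩

variable [IsLocalRing R]

/-- With `μ = ℓ(S / 𝔪S)`, the number of generators of `S ≅ c`, counting the length of `R / 𝔪c`
in two ways gives `μ + ℓ(R / c) = ℓ(𝔪 / c𝔪) + 1`. -/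
theorem length_quotient_maximalIdeal_smul_add (hinj : Function.Injective (algebraMap R S))
    (hx : x ∈ nonZeroDivisors S)
    (hc : ∀ s, s ∈ Ideal.span {x} ↔ ∃ r ∈ c, algebraMap R S r = s) :
    Module.length R (S ⧸ (maximalIdeal R • ⊤ : Submodule R S)) + Module.length R (R ⧸ c) =
      Module.length R (maximalIdeal R ⧸ (c • ⊤ : Submodule R (maximalIdeal R))) + 1 := by
  rw [← length_smul_top_eq_of_principal hinj hx hc, ← length_quotient_ideal_mul, mul_comm,
    length_quotient_ideal_mul, length_quotient_maximalIdeal]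

end CommonIdeal

/-- The numerical consequence of `E ≤ μℓ` and `μ + ℓ = t + 1`, where `t = ℓ(𝔪 / c𝔪)` is at most
`νℓ`, and strictly smaller if `ℓ ≥ 2`. -/
theorem bounds_of_length_relations {E μ ℓ t ν : ℕ} (hℓ : 1 ≤ ℓ) (hE : E ≤ μ * ℓ)
    (hμ : μ + ℓ = t + 1) (ht : t ≤ ν * ℓ) (ht2 : 2 ≤ ν → 2 ≤ ℓ → t + 1 ≤ ν * ℓ) (hlt : ℓ < E)
    (h1 : ℓ = 1 → E = ν) :
    (E : ℝ) ≤ ((ν : ℝ) - 1) * (ℓ : ℝ) ^ 2 + ℓ ∧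
      ((ν : ℝ) - 1) * (ℓ : ℝ) ^ 2 + ℓ ≤ ν * (ℓ : ℝ) ^ 2 ∧
      ((E : ℝ) = ((ν : ℝ) - 1) * (ℓ : ℝ) ^ 2 + ℓ ↔ ℓ = 1) ∧
      ((E : ℝ) = ν * (ℓ : ℝ) ^ 2 ↔ ℓ = 1) := by
  -- `ν ≤ 1` would force `μ ≤ 1`, hence `E ≤ ℓ`
  have hν : 2 ≤ ν := by
    by_contra hν
    have : ν * ℓ ≤ 1 * ℓ := Nat.mul_le_mul_right ℓ (by omega)
    have : μ * ℓ ≤ 1 * ℓ := Nat.mul_le_mul_right ℓ (by omega)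
    omega
  have hsq : (ℓ : ℝ) ≤ (ℓ : ℝ) ^ 2 := by exact_mod_cast Nat.le_self_pow two_ne_zero ℓ
  rcases hℓ.eq_or_lt with rfl | h2
  · simp [h1 rfl]
  · have ht2 := ht2 hν h2
    have hμ' : μ + ℓ ≤ ν * ℓ := by omega
    have hE' : (E : ℝ) ≤ μ * ℓ := by exact_mod_cast hE
    have hμr : (μ : ℝ) + ℓ ≤ ν * ℓ := by exact_mod_cast hμ'
    have hpos : (0 : ℝ) < ℓ := by exact_mod_cast hℓ
    have hmul := mul_le_mul_of_nonneg_right hμr hpos.le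
    have hlt1 : (E : ℝ) < ((ν : ℝ) - 1) * (ℓ : ℝ) ^ 2 + ℓ := by nlinarith
    have hle2 : ((ν : ℝ) - 1) * (ℓ : ℝ) ^ 2 + ℓ ≤ ν * (ℓ : ℝ) ^ 2 := by linarith
    exact ⟨hlt1.le, hle2, ⟨fun h => absurd h hlt1.ne, fun h => by omega⟩,
      ⟨fun h => absurd h (hlt1.trans_le hle2).ne, fun h => by omega⟩⟩

theorem tendsto_hilbertSamuelSeq {R : Type*} [CommRing R] (hdim : ringKrullDim R = 1)
    {I : Ideal R} {E ℓ : ℕ} (h : ∀ n : ℕ, colength (I ^ (n + 1)) = n * E + ℓ) :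
    Tendsto (hilbertSamuelSeq I) atTop (𝓝 (E : ℝ)) := by
  have hd : ((ringKrullDim R).unbotD 0).toNat = 1 := by rw [hdim]; rfl
  -- the formula for the colength starts at the exponent `1`
  rw [← tendsto_add_atTop_iff_nat 1]
  have hlim : Tendsto (fun n : ℕ => (E : ℝ) + ((ℓ : ℝ) - E) * (1 / ((n : ℝ) + 1))) atTop
      (𝓝 (E + (ℓ - E) * 0)) :=
    tendsto_const_nhds.add (tendsto_one_div_add_atTop_nhds_zero_nat.const_mul _)
  rw [mul_zero, add_zero] at hlim
  refine hlim.congr fun n => ?_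
  have : (n : ℝ) + 1 ≠ 0 := by positivity
  simp only [hilbertSamuelSeq, hd, h]
  push_cast
  field_simp
  ring

/-- In a one-dimensional Noetherian local ring, an `𝔪`-primary conductor containing a
non-zero-divisor is generated, as an ideal of the integral closure, by one regular element. -/
theorem exists_conductorIdeal_eq_span {R : Type*} [CommRing R] [IsLocalRing R] [IsNoetherianRing R]
    (hdim : ringKrullDim R = 1) {t : R} (htc : t ∈ conductorIdeal R)
    (ht : t ∈ nonZeroDivisors R) :
    ∃ x ∈ nonZeroDivisors (integralClosure R (FractionRing R)), ∀ s, s ∈ Ideal.span {x} ↔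
      ∃ r ∈ conductorIdeal R, algebraMap R (integralClosure R (FractionRing R)) r = s := by
  set Q := FractionRing R
  set S := integralClosure R Q
  have hTle : Algebra.algebraMapSubmonoid S (nonZeroDivisors R) ≤ nonZeroDivisors S := by
    rintro _ ⟨a, ha, rfl⟩
    refine mem_nonZeroDivisors_iff_right.mpr fun s hs => Subtype.ext ?_
    exact (IsLocalization.map_units Q ⟨a, ha⟩).mul_left_eq_zero.mp (congrArg Subtype.val hs)
  have hloc : IsLocalization (Algebra.algebraMapSubmonoid S (nonZeroDivisors R)) Q :=
    isLocalization_algebraMapSubmonoid_integralClosure _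
  have hnoeth : IsNoetherian R (Subalgebra.toSubmodule S) :=
    isNoetherian_of_forall_smul_mem_one (t := t) (IsLocalization.map_units Q ⟨t, ht⟩)
      fun q hq => by
        obtain ⟨r, hr⟩ := mem_conductorIdeal.mp htc q hq
        exact Submodule.mem_one.mpr ⟨r, by rw [hr, Algebra.smul_def]⟩
  have hfinite : Module.Finite R S := Module.IsNoetherian.finite R (Subalgebra.toSubmodule S)
  have hSnoeth : IsNoetherianRing S := IsNoetherianRing.of_finite R S
  have hart : IsArtinianRing (R ⧸ Ideal.span {t}) := by
    rw [isArtinianRing_iff_krullDimLE_zero, Ring.KrullDimLE, Order.krullDimLE_iff]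
    have := ringKrullDim_quotient_succ_le_of_nonZeroDivisor ht
    rw [hdim] at this
    exact (ENat.WithBot.add_le_add_one_right_iff).mp this
  have hartS := isArtinianRing_quotient_map (S := S) (Ideal.span {t})
  rw [Ideal.map_span, Set.image_singleton] at hartS
  have hint : ∀ q : Q, IsIntegral S q → q ∈ (1 : Submodule S Q) := fun q hq =>
    Submodule.mem_one.mpr ⟨⟨q, isIntegral_trans q hq⟩, rfl⟩
  have htT : algebraMap R S t ∈ Algebra.algebraMapSubmonoid S (nonZeroDivisors R) := ⟨t, ht, rfl⟩
  have htC := Ideal.mem_map_of_mem (algebraMap R S) htc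
  obtain ⟨x, hx⟩ := isPrincipal_of_isIntegrallyClosedIn hTle hint
    (finite_isMaximal_of_finite (R := R)) htT htC
  refine ⟨x, ?_, fun s => by rw [← hx, mem_map_conductorIdeal_iff]⟩
  obtain ⟨a, ha⟩ := Ideal.mem_span_singleton'.mp (hx ▸ htC)
  exact (mul_mem_nonZeroDivisors.mp (ha ▸ hTle htT)).2

/-- The multiplicity of an ideal `c` of a one-dimensional local ring `R` that is also a regular
principal ideal `xS` of a strictly larger ring `S`. The positive powers of `c` are then isomorphic
to `S`, so that `e(c) = ℓ(S / cS)`. -/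
theorem multiplicity_bounds_of_common_principal {R S : Type*} [CommRing R] [IsLocalRing R]
    [IsNoetherianRing R] [CommRing S] [Algebra R S] {c : Ideal R} {x : S} {k : ℕ}
    (hdim : ringKrullDim R = 1) (hinj : Function.Injective (algebraMap R S))
    (hsurj : ¬ Function.Surjective (algebraMap R S)) (hx : x ∈ nonZeroDivisors S)
    (hc : ∀ s, s ∈ Ideal.span {x} ↔ ∃ r ∈ c, algebraMap R S r = s)
    (hcm : c ≤ maximalIdeal R) (hk : maximalIdeal R ^ k ≤ c) :
    Module.length R (R ⧸ c) ≠ ⊤ ∧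
    (∀ n : ℕ, Module.length R (R ⧸ c ^ n) ≠ ⊤) ∧
    Tendsto (hilbertSamuelSeq c) atTop
      (𝓝 (hilbertSamuelMultiplicity c)) ∧
    hilbertSamuelMultiplicity c ≤
      ((embeddingDim R : ℝ) - 1) * (colength c : ℝ) ^ 2
        + (colength c : ℝ) ∧
    ((embeddingDim R : ℝ) - 1) * (colength c : ℝ) ^ 2
        + (colength c : ℝ) ≤
      (embeddingDim R : ℝ) * (colength c : ℝ) ^ 2 ∧
    (hilbertSamuelMultiplicity c =
        ((embeddingDim R : ℝ) - 1) * (colength c : ℝ) ^ 2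
          + (colength c : ℝ) ↔
      colength c = 1) ∧
    (hilbertSamuelMultiplicity c =
        (embeddingDim R : ℝ) * (colength c : ℝ) ^ 2 ↔
      colength c = 1) := by
  have hfin : ∀ n : ℕ, Module.length R (R ⧸ c ^ n) ≠ ⊤ := fun n =>
    length_quotient_ne_top ⟨k * n, by rw [pow_mul]; exact Ideal.pow_right_mono hk n⟩
  have hℓfin : Module.length R (R ⧸ c) ≠ ⊤ := length_quotient_ne_top ⟨k, hk⟩
  have hE := length_smul_top_le_mul S ⟨k, hk⟩
  have hμ := length_quotient_maximalIdeal_smul_add hinj hx hc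
  have ht := length_smul_top_le_mul (maximalIdeal R) ⟨k, hk⟩
  have ht2 : 2 ≤ embeddingDim R → 2 ≤ Module.length R (R ⧸ c) →
      Module.length R (maximalIdeal R ⧸ (c • ⊤ : Submodule R (maximalIdeal R))) + 1 ≤
      embeddingDim R * Module.length R (R ⧸ c) := fun hν h2 =>
    length_maximalIdeal_smul_lt hν ⟨k, hk⟩ <| hcm.lt_of_ne fun h => by
      rw [h, length_quotient_maximalIdeal] at h2
      exact absurd h2 (by decide)
  have hlt := length_quotient_lt_length_smul_top hc hinj hsurj hℓfin
  have hpow := length_quotient_pow_succ hinj hx hc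
  have hℓ1 : 1 ≤ Module.length R (R ⧸ c) := by
    rw [← length_quotient_maximalIdeal (R := R)]
    exact Module.length_le_of_surjective _ (Submodule.factor_surjective hcm)
  have h1 : Module.length R (R ⧸ c) = 1 →
      Module.length R (S ⧸ (c • ⊤ : Submodule R S)) = embeddingDim R := fun h1 => by
    have hceq : c = maximalIdeal R := by
      refine hcm.eq_of_not_lt fun h => ?_
      have := length_quotient_add_one_le h
      rw [h1, length_quotient_maximalIdeal] at this
      exact absurd this (by decide)
    rw [hceq, length_maximalIdeal_smul, length_quotient_maximalIdeal] at hμ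
    rw [hceq]
    exact WithTop.add_right_cancel ENat.one_ne_top hμ
  rw [length_maximalIdeal_smul] at ht
  have htfin : Module.length R (maximalIdeal R ⧸ (c • ⊤ : Submodule R (maximalIdeal R))) ≠ ⊤ :=
    ne_top_of_le_ne_top (WithTop.mul_ne_top (ENat.natCast_ne_top _) hℓfin) ht
  have hμfin : Module.length R (S ⧸ (maximalIdeal R • ⊤ : Submodule R S)) ≠ ⊤ :=
    ne_top_of_le_ne_top (WithTop.add_ne_top.mpr ⟨htfin, ENat.one_ne_top⟩) (hμ ▸ le_self_add)
  have hEfin := ne_top_of_le_ne_top (WithTop.mul_ne_top hμfin hℓfin) hE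
  have hcol : Module.length R (R ⧸ c) = (colength c : ℕ∞) := (ENat.natCast_toNat hℓfin).symm
  obtain ⟨E, hEeq⟩ := ENat.ne_top_iff_exists.mp hEfin
  obtain ⟨μ, hμeq⟩ := ENat.ne_top_iff_exists.mp hμfin
  obtain ⟨t, hteq⟩ := ENat.ne_top_iff_exists.mp htfin
  simp only [hcol, ← hEeq, ← hμeq, ← hteq] at hE hμ ht ht2 hlt hpow hℓ1 h1
  have hlim := tendsto_hilbertSamuelSeq hdim (I := c) (E := E) (ℓ := colength c) fun n => by
    rw [colength, hpow n]
    exact_mod_cast ENat.toNat_natCast (n * E + colength c)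
  have hmult : hilbertSamuelMultiplicity c = E := hlim.limUnder_eq
  rw [hmult]
  norm_cast at hE hμ ht ht2 hlt hℓ1 h1
  exact ⟨hℓfin, hfin, hlim,
    bounds_of_length_relations hℓ1 hE hμ ht ht2 hlt h1⟩

theorem corollary1p3 (R : Type*) [CommRing R] [IsCohenMacaulayLocalRing R]
    (hdim : ringKrullDim R = 1)
    (hunram : IsAnalyticallyUnramified R)
    (hinf : Infinite (IsLocalRing.ResidueField R))
    (hprim : (conductorIdeal R).IsPrimary)
    (hrad : (conductorIdeal R).radical = IsLocalRing.maximalIdeal R) :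
    -- the lengths are finite and the limit defining the multiplicity of the conductor exists
    Module.length R (R ⧸ conductorIdeal R) ≠ ⊤ ∧
    (∀ n : ℕ, Module.length R (R ⧸ conductorIdeal R ^ n) ≠ ⊤) ∧
    Tendsto (hilbertSamuelSeq (conductorIdeal R)) atTop
      (𝓝 (hilbertSamuelMultiplicity (conductorIdeal R))) ∧
    -- the two bounds
    hilbertSamuelMultiplicity (conductorIdeal R) ≤
      ((embeddingDim R : ℝ) - 1) * (colength (conductorIdeal R) : ℝ) ^ 2
        + (colength (conductorIdeal R) : ℝ) ∧
    ((embeddingDim R : ℝ) - 1) * (colength (conductorIdeal R) : ℝ) ^ 2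
        + (colength (conductorIdeal R) : ℝ) ≤
      (embeddingDim R : ℝ) * (colength (conductorIdeal R) : ℝ) ^ 2 ∧
    -- equality in either bound
    (hilbertSamuelMultiplicity (conductorIdeal R) =
        ((embeddingDim R : ℝ) - 1) * (colength (conductorIdeal R) : ℝ) ^ 2
          + (colength (conductorIdeal R) : ℝ) ↔
      colength (conductorIdeal R) = 1) ∧
    (hilbertSamuelMultiplicity (conductorIdeal R) =
        (embeddingDim R : ℝ) * (colength (conductorIdeal R) : ℝ) ^ 2 ↔
      colength (conductorIdeal R) = 1) := by
  obtain ⟨a, ham, ha⟩ := exists_mem_nonZeroDivisors_of_localDepth_eq_one (R := R) <| by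
    have := IsCohenMacaulayLocalRing.depth_eq_dim (R := R)
    rw [hdim] at this
    exact_mod_cast this
  obtain ⟨n, hn⟩ := Ideal.mem_radical_iff.mp (hrad ▸ ham : a ∈ (conductorIdeal R).radical)
  obtain ⟨x, hx, hc⟩ := exists_conductorIdeal_eq_span hdim hn (pow_mem ha n)
  have hinj : Function.Injective (algebraMap R (integralClosure R (FractionRing R))) :=
    fun p q hpq => IsFractionRing.injective R (FractionRing R) (congrArg Subtype.val hpq)
  have hcm : conductorIdeal R ≤ maximalIdeal R := hrad ▸ Ideal.le_radical
  -- a surjective map would give `1 ∈ c`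
  have hsurj : ¬ Function.Surjective (algebraMap R (integralClosure R (FractionRing R))) :=
      fun hsurj => by
    have : (1 : R) ∈ conductorIdeal R := mem_conductorIdeal.mpr fun y hy => by
      obtain ⟨s, hs⟩ := hsurj ⟨y, hy⟩
      exact ⟨s, by rw [map_one, one_mul]; exact congrArg Subtype.val hs⟩
    exact (maximalIdeal.isMaximal R).ne_top ((Ideal.eq_top_iff_one _).mpr (hcm this))
  obtain ⟨k, hk⟩ : ∃ k, maximalIdeal R ^ k ≤ conductorIdeal R :=
    hrad ▸ Ideal.exists_radical_pow_le_of_fg _ (IsNoetherian.noetherian _)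
  exact multiplicity_bounds_of_common_principal hdim hinj hsurj hx hc hcm hk
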